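/- Let $n\ge 1$, let $M_n$ be the space of complex $n\times n$ matrices, and let $|||\cdot|||$ be a unitarily invariant norm on $M_n$, that is, a norm with $|||UXV|||=|||X|||$ for all $X\in M_n$ and all unitary $U,V\in M_n$. For $X\in M_n$ put $|X|=(X^*X)^{1/2}$. Let $A,B,C\in M_n$. Then for every real $p\ge 2$, $$\big|\big|\big|\,|A+B|^p+|B+C|^p+|C+A|^p\,\big|\big|\big|\le 2^{p-2}\,\big|\big|\big|\,|A+B+C|^p+|A|^p+|B|^p+|C|^p\,\big|\big|\big|,$$ and for every real $0<p\le 2$ the reversed inequality $$\big|\big|\big|\,|A+B|^p+|B+C|^p+|C+A|^p\,\big|\big|\big|\ge 2^{p-2}\,\big|\big|\big|\,|A+B+C|^p+|A|^p+|B|^p+|C|^p\,\big|\big|\big|$$ holds. Moreover, the constant $2^{p-2}$ is optimal: for every $p>0$ equality holds whenever $A=B=-C\ne 0$. Consequently, for every $n\ge1$ and every unitarily invariant norm on $M_n$, if $p\ge2$ and the first inequality holds for all $A,B,C\in M_n$ with a real constant $c$ in place of $2^{p-2}$, then $c\ge 2^{p-2}$; and if $0<p\le2$ and the second inequality holds for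 all $A,B,C\in M_n$ with $c$ in place of $2^{p-2}$, then $c\le 2^{p-2}$. -/

import Mathlib

/-- `matAbsPow X p` is the matrix `|X|^p`, where `|X| = (Xᴴ X)^{1/2}` and the real power of the
positive semidefinite matrix `|X|` is taken in the functional calculus. -/
noncomputable def matAbsPow {n : ℕ} (X : Matrix (Fin n) (Fin n) ℂ) (p : ℝ) :
    Matrix (Fin n) (Fin n) ℂ :=
  open scoped MatrixOrder in CFC.abs X ^ p

/-- A seminorm on the complex `n × n` matrices is a unitarily invariant norm if it is definite and
`N (U X V) = N X` for all `X` and all unitary `U`, `V`. -/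
structure IsUnitarilyInvariantNorm {n : ℕ} (N : Seminorm ℂ (Matrix (Fin n) (Fin n) ℂ)) :
    Prop where
  definite : ∀ X, N X = 0 → X = 0
  invariant : ∀ U ∈ Matrix.unitaryGroup (Fin n) ℂ, ∀ V ∈ Matrix.unitaryGroup (Fin n) ℂ,
    ∀ X, N (U * X * V) = N X

/-!
With `q = p / 2` one has `|X| ^ p = (Xᴴ X) ^ q`, and expanding the products shows that
`|A + B|² + |B + C|² + |C + A|² = |A + B + C|² + |A|² + |B|² + |C|²`. Call the three summands on the
left `Xₖ` and the four on the right `Yₖ`. For `q ≥ 1`,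

`N (∑ Xₖ ^ q) ≤ N ((∑ Xₖ) ^ q) = N ((∑ Yₖ) ^ q) ≤ 4 ^ (q - 1) * N (∑ Yₖ ^ q)`,

where the first step is superadditivity of convex powers (`map_sum_rpow_ge`) and the last one is
convexity (`map_sum_rpow_le_card_mul`). For `q ≤ 1` both steps are reversed: `map_sum_rpow_le` is
the Ando–Zhan subadditivity inequality and `card_mul_map_sum_rpow_le` is operator concavity of
`t ^ q`. The constant is `4 ^ (q - 1) = 2 ^ (p - 2)`, and `A = B = -C` gives equality since then only
`2A` survives on one side and four matrices `±A` on the other.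

The norm inequalities are reduced to weak majorization. If a positive semidefinite matrix has
eigenvalues `l` in decreasing order with eigenvectors `uᵢ`, and `∑ wᵢ lᵢ ≤ ∑ wᵢ ⟨uᵢ, Y uᵢ⟩` for all
decreasing nonnegative weights `w`, then its norm is at most `N Y`
(`le_of_weighted_sum_conjDiag_le`). This follows from pinching together with a Hahn–Banach and
rearrangement argument on diagonal matrices. Testing against all such weights is equivalent to
comparing partial sums, and makes the partial sums themselves unnecessary.

The heart of the matter is `weighted_sum_rpow_le_conjDiag`: for `q ≤ 1` and `S = ∑ Aₖ`, the diagonal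
of `(S + δ)^{(q-1)/2} A (S + δ)^{(q-1)/2}` in the eigenbasis of `S` is weakly dominated by that of
`A^{1/2} (S + δ)^{q-1} A^{1/2}`, which is at most `A ^ q` because `t ^ (q - 1)` is operator antitone.
Summing over `k` and letting `δ → 0` bounds the eigenvalues of `S ^ q`.
-/

section

open Matrix Filter Topology
open scoped ComplexOrder MatrixOrder Matrix.Norms.L2Operator

/-! ### Diagonals, pinching and weak majorization -/

/-- The real parts of the diagonal entries of `Uᴴ X U`; when `U` is unitary these are the real parts
of the numbers `⟨uᵢ, X uᵢ⟩`, where `uᵢ` are the columns of `U`. -/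
noncomputable def conjDiag {n : ℕ} (U X : Matrix (Fin n) (Fin n) ℂ) (i : Fin n) : ℝ :=
  ((Uᴴ * X * U) i i).re

theorem conjDiag_add {n : ℕ} (U X Y : Matrix (Fin n) (Fin n) ℂ) (i : Fin n) :
    conjDiag U (X + Y) i = conjDiag U X i + conjDiag U Y i := by
  simp [conjDiag, Matrix.mul_add, Matrix.add_mul]

theorem conjDiag_smul {n : ℕ} (U X : Matrix (Fin n) (Fin n) ℂ) (c : ℝ) (i : Fin n) :
    conjDiag U (c • X) i = c * conjDiag U X i := by
  simp [conjDiag]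

theorem conjDiag_sum {n : ℕ} {ι : Type*} (s : Finset ι) (U : Matrix (Fin n) (Fin n) ℂ)
    (X : ι → Matrix (Fin n) (Fin n) ℂ) (i : Fin n) :
    conjDiag U (∑ k ∈ s, X k) i = ∑ k ∈ s, conjDiag U (X k) i := by
  simp [conjDiag, Matrix.mul_sum, Matrix.sum_mul, Matrix.sum_apply]

theorem conjDiag_nonneg {n : ℕ} (U : Matrix (Fin n) (Fin n) ℂ) {X : Matrix (Fin n) (Fin n) ℂ}
    (hX : 0 ≤ X) (i : Fin n) : 0 ≤ conjDiag U X i := by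
  have h := (Matrix.nonneg_iff_posSemidef.1 hX).conjTranspose_mul_mul_same U
  exact (Complex.le_def.1 (h.diag_nonneg (i := i))).1

theorem conjDiag_mono {n : ℕ} (U : Matrix (Fin n) (Fin n) ℂ) {X Y : Matrix (Fin n) (Fin n) ℂ}
    (h : X ≤ Y) (i : Fin n) : conjDiag U X i ≤ conjDiag U Y i := by
  have h1 := conjDiag_nonneg U (sub_nonneg.2 h) i
  have h2 := conjDiag_add U (Y - X) X i
  rw [sub_add_cancel] at h2
  linarith

theorem diagonal_sign_mem_unitaryGroup {n : ℕ} {s : Fin n → ℝ} (hs : ∀ i, s i * s i = 1) :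
    diagonal (fun i => (s i : ℂ)) ∈ unitaryGroup (Fin n) ℂ := by
  rw [mem_unitaryGroup_iff, star_eq_conjTranspose, diagonal_conjTranspose, diagonal_mul_diagonal,
    ← diagonal_one]
  congr 1
  funext i
  simp only [Pi.star_apply, Complex.star_def, Complex.conj_ofReal, ← Complex.ofReal_mul, hs,
    Complex.ofReal_one]

namespace IsUnitarilyInvariantNorm

variable {n : ℕ} {N : Seminorm ℂ (Matrix (Fin n) (Fin n) ℂ)}

theorem map_conj (hN : IsUnitarilyInvariantNorm N) {U : Matrix (Fin n) (Fin n) ℂ}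
    (hU : U ∈ unitaryGroup (Fin n) ℂ) (X : Matrix (Fin n) (Fin n) ℂ) :
    N (U * X * Uᴴ) = N X :=
  hN.invariant U hU Uᴴ (Unitary.star_mem hU) X

theorem map_conj' (hN : IsUnitarilyInvariantNorm N) {U : Matrix (Fin n) (Fin n) ℂ}
    (hU : U ∈ unitaryGroup (Fin n) ℂ) (X : Matrix (Fin n) (Fin n) ℂ) :
    N (Uᴴ * X * U) = N X :=
  hN.invariant Uᴴ (Unitary.star_mem hU) U hU X

/-- Pinching: the diagonal part of `X` is the average of the matrices `D X D` over all diagonal sign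
matrices `D`, so its norm is at most that of `X`. -/
theorem map_diagonal_le (hN : IsUnitarilyInvariantNorm N) (X : Matrix (Fin n) (Fin n) ℂ) :
    N (diagonal fun i => X i i) ≤ N X := by
  let D : (Fin n → ℤˣ) → Matrix (Fin n) (Fin n) ℂ := fun ε =>
    diagonal fun i => (((ε i : ℤ) : ℝ) : ℂ)
  have hD : ∀ ε, D ε ∈ unitaryGroup (Fin n) ℂ := fun ε =>
    diagonal_sign_mem_unitaryGroup (fun i => by
      rcases Int.units_eq_one_or (ε i) with h | h <;> simp [h])
  have hsum : ∑ ε, D ε * X * D ε = (Fintype.card (Fin n → ℤˣ) : ℂ) • diagonal fun i => X i i := by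
    ext i j
    have hent : ∀ ε, (D ε * X * D ε) i j = ((ε i : ℤ) : ℂ) * X i j * ((ε j : ℤ) : ℂ) := by
      intro ε
      simp [D]
    rw [Matrix.sum_apply]
    simp only [hent, Matrix.smul_apply, smul_eq_mul]
    by_cases hij : i = j
    · subst hij
      have : ∀ ε : Fin n → ℤˣ, ((ε i : ℤ) : ℂ) * X i i * ((ε i : ℤ) : ℂ) = X i i := by
        intro ε
        rcases Int.units_eq_one_or (ε i) with h | h <;> simp [h]
      simp [this]
    · rw [diagonal_apply_ne _ hij, mul_zero]
      -- flipping the sign at `i` is a bijection that negates every term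
      have hflip := Fintype.sum_equiv (Equiv.mulRight (Pi.mulSingle i (-1) : Fin n → ℤˣ))
        (fun ε => -(((ε i : ℤ) : ℂ) * X i j * ((ε j : ℤ) : ℂ)))
        (fun ε => ((ε i : ℤ) : ℂ) * X i j * ((ε j : ℤ) : ℂ)) (fun ε => by
          simp [Pi.mulSingle_eq_of_ne (Ne.symm hij)])
      rw [Finset.sum_neg_distrib] at hflip
      exact self_eq_neg.1 hflip.symm
  have hle : N (∑ ε, D ε * X * D ε) ≤ ∑ _ε : Fin n → ℤˣ, N X :=
    (Finset.le_sum_of_subadditive N (map_zero N).le (map_add_le_add N) _ _).trans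
      (Finset.sum_le_sum fun ε _ => (hN.invariant _ (hD ε) _ (hD ε) X).le)
  rw [hsum, map_smul_eq_mul, Finset.sum_const, Finset.card_univ, nsmul_eq_mul] at hle
  have hpos : (0 : ℝ) < Fintype.card (Fin n → ℤˣ) := by exact_mod_cast Fintype.card_pos
  rw [Complex.norm_natCast] at hle
  exact le_of_mul_le_mul_left hle hpos

theorem map_submatrix (hN : IsUnitarilyInvariantNorm N) (σ : Equiv.Perm (Fin n))
    (X : Matrix (Fin n) (Fin n) ℂ) : N (X.submatrix σ σ) = N X := by
  have hσ : σ.permMatrix ℂ ∈ unitaryGroup (Fin n) ℂ := by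
    rw [mem_unitaryGroup_iff, star_eq_conjTranspose, conjTranspose_permMatrix, ← permMatrix_mul]
    simp
  rw [← hN.map_conj hσ X, conjTranspose_permMatrix]
  congr 1
  simp only [Equiv.Perm.permMatrix, PEquiv.toMatrix_toPEquiv_mul, PEquiv.mul_toMatrix_toPEquiv,
    submatrix_submatrix]
  rfl

/-- A form of Ky Fan dominance on diagonal matrices: if `l` is decreasing and nonnegative and
`∑ wᵢ lᵢ ≤ ∑ wᵢ dᵢ` for all decreasing nonnegative weights `w`, then `N (diag l) ≤ N (diag d)`. A
functional dominated by `N` that supports it at `diag l` becomes such a weight after its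
coefficients are replaced by their absolute values and sorted. -/
theorem map_diagonal_le_of_weighted_sum_le (hN : IsUnitarilyInvariantNorm N) {l d : Fin n → ℝ}
    (hl : Antitone l) (hl0 : ∀ i, 0 ≤ l i)
    (h : ∀ w : Fin n → ℝ, Antitone w → (∀ i, 0 ≤ w i) → ∑ i, w i * l i ≤ ∑ i, w i * d i) :
    N (diagonal fun i => (l i : ℂ)) ≤ N (diagonal fun i => (d i : ℂ)) := by
  let φ : (Fin n → ℝ) → ℝ := fun x => N (diagonal fun i => (x i : ℂ))
  change φ l ≤ φ d
  have hφ_smul : ∀ (c : ℝ) (x : Fin n → ℝ), φ (c • x) = |c| * φ x := by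
    intro c x
    have : (diagonal fun i => ((c • x) i : ℂ)) = (c : ℂ) • diagonal fun i => (x i : ℂ) := by
      rw [← diagonal_smul]
      congr 1
      funext i
      simp
    simp only [φ]
    rw [this, map_smul_eq_mul, Complex.norm_real, Real.norm_eq_abs]
  have hφ_add : ∀ x y : Fin n → ℝ, φ (x + y) ≤ φ x + φ y := by
    intro x y
    have : (diagonal fun i => ((x + y) i : ℂ)) =
        (diagonal fun i => (x i : ℂ)) + diagonal fun i => (y i : ℂ) := by
      rw [diagonal_add]
      congr 1
      funext i
      simp
    simp only [φ]
    rw [this]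
    exact map_add_le_add _ _ _
  by_cases hl_zero : l = 0
  · subst hl_zero
    simp [φ]
  obtain ⟨f, hf, hfφ⟩ := exists_extension_of_le_sublinear
    (LinearPMap.mkSpanSingleton l (φ l) hl_zero : (Fin n → ℝ) →ₗ.[ℝ] ℝ) φ
    (fun c hc x => by rw [hφ_smul, abs_of_pos hc]) hφ_add (by
      rintro ⟨x, hx⟩
      obtain ⟨c, rfl⟩ := Submodule.mem_span_singleton.1 hx
      rw [LinearPMap.mkSpanSingleton'_apply, hφ_smul]
      exact mul_le_mul_of_nonneg_right (le_abs_self c) (apply_nonneg N _))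
  have hfl : f l = φ l := by
    have := hf ⟨l, Submodule.mem_span_singleton_self l⟩
    rw [this]
    exact LinearPMap.mkSpanSingleton_apply ℝ ℝ hl_zero (φ l)
  let y : Fin n → ℝ := fun i => f (Pi.single i 1)
  have hfy : ∀ x, f x = ∑ i, y i * x i := by
    intro x
    conv_lhs => rw [← Finset.univ_sum_single x, map_sum]
    refine Finset.sum_congr rfl fun i _ => ?_
    have : (Pi.single i (x i) : Fin n → ℝ) = x i • Pi.single i 1 := by
      rw [← Pi.single_smul, smul_eq_mul, mul_one]
    rw [this, map_smul, smul_eq_mul, mul_comm]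
  let σ : Equiv.Perm (Fin n) := Tuple.sort fun i => -|y i|
  let w : Fin n → ℝ := fun i => |y (σ i)|
  have hw : Antitone w := fun i j hij => by
    have := Tuple.monotone_sort (fun i => -|y i|) hij
    simpa [w, σ] using this
  let s : Fin n → ℝ := fun i => if 0 ≤ y i then 1 else -1
  have hs : ∀ i, s i * s i = 1 := fun i => by
    by_cases hi : 0 ≤ y i <;> simp [s, hi]
  have hys : ∀ i, y i * s i = |y i| := fun i => by
    by_cases hi : 0 ≤ y i
    · simp [s, hi, abs_of_nonneg hi]
    · simp [s, hi, abs_of_neg (not_le.1 hi)]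
  have hmono : Monovary w l := hw.monovary hl
  have hinv : φ (fun i => s i * d (σ.symm i)) = φ d := by
    have h1 := hN.invariant _ (diagonal_sign_mem_unitaryGroup hs) 1 (one_mem _)
      (diagonal fun i => (d (σ.symm i) : ℂ))
    rw [diagonal_mul_diagonal, mul_one] at h1
    have h2 := hN.map_submatrix σ (diagonal fun i => (d (σ.symm i) : ℂ))
    rw [submatrix_diagonal_equiv] at h2
    simp only [φ, Complex.ofReal_mul]
    rw [h1, ← h2]
    congr 2
    funext i
    simp
  calc φ l = ∑ i, y i * l i := by rw [← hfl, hfy]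
    _ ≤ ∑ i, w (σ.symm i) * l i := Finset.sum_le_sum fun i _ => by
        simpa [w] using mul_le_mul_of_nonneg_right (le_abs_self (y i)) (hl0 i)
    _ ≤ ∑ i, w i * l i := hmono.sum_comp_perm_mul_le_sum_mul
    _ ≤ ∑ i, w i * d i := h w hw fun i => abs_nonneg _
    _ = ∑ i, w (σ.symm i) * d (σ.symm i) := (Equiv.sum_comp σ.symm fun i => w i * d i).symm
    _ = ∑ i, y i * (s i * d (σ.symm i)) := Finset.sum_congr rfl fun i _ => by
        rw [← mul_assoc, hys]
        simp [w]
    _ = f (fun i => s i * d (σ.symm i)) := (hfy _).symm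
    _ ≤ φ (fun i => s i * d (σ.symm i)) := hfφ _
    _ = φ d := hinv

/-- Ky Fan dominance for a positive semidefinite matrix with decreasing eigenvalues `l` in the
orthonormal basis formed by the columns of `U`, compared with the diagonal of `Y` in that basis. -/
theorem le_of_weighted_sum_conjDiag_le (hN : IsUnitarilyInvariantNorm N)
    {U Y : Matrix (Fin n) (Fin n) ℂ} (hU : U ∈ unitaryGroup (Fin n) ℂ) (hY : Y.IsHermitian)
    {l : Fin n → ℝ} (hl : Antitone l) (hl0 : ∀ i, 0 ≤ l i)
    (h : ∀ w : Fin n → ℝ, Antitone w → (∀ i, 0 ≤ w i) →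
      ∑ i, w i * l i ≤ ∑ i, w i * conjDiag U Y i) :
    N (U * diagonal (fun i => (l i : ℂ)) * Uᴴ) ≤ N Y := by
  rw [hN.map_conj hU]
  refine (hN.map_diagonal_le_of_weighted_sum_le hl hl0 h).trans ?_
  have hd : (fun i => (conjDiag U Y i : ℂ)) = fun i => (Uᴴ * Y * U) i i := by
    funext i
    exact (isHermitian_conjTranspose_mul_mul U hY).coe_re_apply_self i
  rw [hd]
  exact (hN.map_diagonal_le _).trans (hN.map_conj' hU Y).le

end IsUnitarilyInvariantNorm

/-! ### Spectral decompositions and the functional calculus -/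

/-- Spectral theorem with eigenvalues in decreasing order, together with its consequence for the
functional calculus. -/
theorem Matrix.IsHermitian.exists_antitone_diagonalization {n : ℕ} {S : Matrix (Fin n) (Fin n) ℂ}
    (hS : S.IsHermitian) :
    ∃ U ∈ unitaryGroup (Fin n) ℂ, ∃ l : Fin n → ℝ, Antitone l ∧ (0 ≤ S → ∀ i, 0 ≤ l i) ∧
      ∀ f : ℝ → ℝ, cfc f S = U * diagonal (fun i => (f (l i) : ℂ)) * Uᴴ := by
  let σ : Equiv.Perm (Fin n) := Tuple.sort fun i => -hS.eigenvalues i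
  let P : Matrix (Fin n) (Fin n) ℂ := σ.permMatrix ℂ
  have hP : Pᴴ ∈ unitaryGroup (Fin n) ℂ := by
    rw [mem_unitaryGroup_iff, star_eq_conjTranspose, conjTranspose_conjTranspose,
      conjTranspose_permMatrix, ← permMatrix_mul]
    simp
  refine ⟨(hS.eigenvectorUnitary : Matrix (Fin n) (Fin n) ℂ) * Pᴴ,
    mul_mem hS.eigenvectorUnitary.2 hP, fun i => hS.eigenvalues (σ i), fun i j hij => ?_,
    fun h i => (nonneg_iff_posSemidef.1 h).eigenvalues_nonneg _, fun f => ?_⟩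
  · simpa using Tuple.monotone_sort (fun i => -hS.eigenvalues i) hij
  · have hPd : Pᴴ * diagonal (fun i => (f (hS.eigenvalues (σ i)) : ℂ)) * P =
        diagonal (fun i => (f (hS.eigenvalues i) : ℂ)) := by
      simp only [P, conjTranspose_permMatrix, Equiv.Perm.permMatrix, PEquiv.toMatrix_toPEquiv_mul,
        PEquiv.mul_toMatrix_toPEquiv, submatrix_submatrix]
      ext i j
      by_cases hij : i = j
      · subst hij
        simp
      · simp [hij]
    rw [hS.cfc_eq, IsHermitian.cfc, Unitary.conjStarAlgAut_apply, conjTranspose_mul,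
      conjTranspose_conjTranspose]
    calc _ = (hS.eigenvectorUnitary : Matrix (Fin n) (Fin n) ℂ) *
          diagonal (fun i => (f (hS.eigenvalues i) : ℂ)) *
            (hS.eigenvectorUnitary : Matrix (Fin n) (Fin n) ℂ)ᴴ := rfl
      _ = _ := by
        rw [← hPd]
        simp only [Matrix.mul_assoc]

variable {n : ℕ}

theorem isHermitian_of_nonneg {S : Matrix (Fin n) (Fin n) ℂ} (hS : 0 ≤ S) : S.IsHermitian :=
  (nonneg_iff_posSemidef.1 hS).isHermitian

theorem continuousOn_spectrum_real (S : Matrix (Fin n) (Fin n) ℂ) (f : ℝ → ℝ) :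
    ContinuousOn f (spectrum ℝ S) :=
  S.finite_real_spectrum.continuousOn f

theorem conjDiag_diagonalization {U : Matrix (Fin n) (Fin n) ℂ} (hU : U ∈ unitaryGroup (Fin n) ℂ)
    (l : Fin n → ℝ) (i : Fin n) :
    conjDiag U (U * diagonal (fun i => (l i : ℂ)) * Uᴴ) i = l i := by
  have hUU : Uᴴ * U = 1 := mem_unitaryGroup_iff'.1 hU
  have : Uᴴ * (U * diagonal (fun i => (l i : ℂ)) * Uᴴ) * U = diagonal (fun i => (l i : ℂ)) := by
    calc _ = (Uᴴ * U) * diagonal (fun i => (l i : ℂ)) * (Uᴴ * U) := by simp only [Matrix.mul_assoc]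
      _ = _ := by rw [hUU, Matrix.one_mul, Matrix.mul_one]
  rw [conjDiag, this, diagonal_apply_eq, Complex.ofReal_re]

/-- In any orthonormal basis, the diagonal of `f(A)` consists of averages of the values of `f` at the
eigenvalues of `A`, with weights that do not depend on `f`. -/
theorem exists_conjDiag_cfc_eq_sum {A U : Matrix (Fin n) (Fin n) ℂ} (hA : 0 ≤ A)
    (hU : U ∈ unitaryGroup (Fin n) ℂ) (i : Fin n) :
    ∃ w a : Fin n → ℝ, (∀ j, 0 ≤ w j) ∧ ∑ j, w j = 1 ∧ (∀ j, 0 ≤ a j) ∧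
      ∀ f : ℝ → ℝ, conjDiag U (cfc f A) i = ∑ j, w j * f (a j) := by
  obtain ⟨W, hW, a, -, ha0, hWa⟩ := (isHermitian_of_nonneg hA).exists_antitone_diagonalization
  have key : ∀ f : ℝ → ℝ,
      conjDiag U (cfc f A) i = ∑ j, Complex.normSq ((Wᴴ * U) j i) * f (a j) := by
    intro f
    have h1 : Uᴴ * cfc f A * U = (Wᴴ * U)ᴴ * diagonal (fun i => (f (a i) : ℂ)) * (Wᴴ * U) := by
      rw [hWa f, conjTranspose_mul, conjTranspose_conjTranspose]
      simp only [Matrix.mul_assoc]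
    rw [conjDiag, h1, Matrix.mul_apply, Complex.re_sum]
    refine Finset.sum_congr rfl fun j _ => ?_
    rw [mul_diagonal, conjTranspose_apply, Complex.star_def, mul_right_comm,
      ← Complex.normSq_eq_conj_mul_self, ← Complex.ofReal_mul, Complex.ofReal_re]
  refine ⟨fun j => Complex.normSq ((Wᴴ * U) j i), a, fun j => Complex.normSq_nonneg _, ?_, ha0 hA,
    key⟩
  have h1 := key fun _ => 1
  rw [cfc_const_one ℝ A (IsSelfAdjoint.of_nonneg hA)] at h1
  have hUU : Uᴴ * U = 1 := mem_unitaryGroup_iff'.1 hU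
  simpa [conjDiag, hUU] using h1.symm

theorem conjDiag_cfc_id {A U : Matrix (Fin n) (Fin n) ℂ} (hA : 0 ≤ A) (i : Fin n) :
    conjDiag U (cfc (fun x : ℝ => x) A) i = conjDiag U A i := by
  rw [cfc_id' ℝ A (IsSelfAdjoint.of_nonneg hA)]

/-- Jensen's inequality `⟨u, A u⟩ ^ q ≤ ⟨u, A ^ q u⟩` for a unit vector `u` and `q ≥ 1`. -/
theorem conjDiag_rpow_le {A U : Matrix (Fin n) (Fin n) ℂ} (hA : 0 ≤ A)
    (hU : U ∈ unitaryGroup (Fin n) ℂ) {q : ℝ} (hq : 1 ≤ q) (i : Fin n) :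
    conjDiag U A i ^ q ≤ conjDiag U (A ^ q) i := by
  obtain ⟨w, a, hw, hw1, ha, h⟩ := exists_conjDiag_cfc_eq_sum hA hU i
  rw [CFC.rpow_eq_cfc_real hA, h, ← conjDiag_cfc_id hA, h]
  exact Real.rpow_arith_mean_le_arith_mean_rpow _ _ _ (fun j _ => hw j) hw1 (fun j _ => ha j) hq

theorem CFC.smul_rpow {A : Matrix (Fin n) (Fin n) ℂ} (hA : 0 ≤ A) {c : ℝ} (hc : 0 ≤ c) (q : ℝ) :
    (c • A) ^ q = c ^ q • A ^ q := by
  have hH : IsSelfAdjoint A := IsSelfAdjoint.of_nonneg hA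
  rw [CFC.rpow_eq_cfc_real hA, CFC.rpow_eq_cfc_real (smul_nonneg hc hA),
    ← cfc_smul (c ^ q) (fun x : ℝ => x ^ q) A (continuousOn_spectrum_real _ _)]
  conv_lhs => rw [← cfc_const_mul_id c A hH]
  rw [← cfc_comp' _ _ A (((A.finite_real_spectrum).image _).continuousOn _)
    (continuousOn_spectrum_real _ _) hH]
  refine cfc_congr fun x hx => ?_
  simp only [smul_eq_mul]
  exact Real.mul_rpow hc (spectrum_nonneg_of_nonneg hA hx)

/-- The map `t ↦ t ^ (-r)` is operator antitone for `0 ≤ r ≤ 1`. -/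
theorem CFC.rpow_neg_le_rpow_neg {A B : Matrix (Fin n) (Fin n) ℂ} (hA : IsStrictlyPositive A)
    (hAB : A ≤ B) {r : ℝ} (hr : r ∈ Set.Icc (0 : ℝ) 1) : B ^ (-r) ≤ A ^ (-r) := by
  have hB : IsStrictlyPositive B := hA.of_le hAB
  rcases hr.1.eq_or_lt with rfl | hr0
  · rw [neg_zero, CFC.rpow_zero _ hA.nonneg, CFC.rpow_zero _ hB.nonneg]
  · have h := CStarAlgebra.rpow_neg_one_le_rpow_neg_one (CFC.rpow_le_rpow hr hAB) (hA.rpow A r)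
    rwa [CFC.rpow_rpow _ _ _ hr0.ne' hA, CFC.rpow_rpow _ _ _ hr0.ne' hB, mul_neg_one] at h

/-! ### Powers of sums of positive semidefinite matrices -/

/-- For a Hermitian `P`, weights `w` decreasing and `K` increasing, moving the factor `K` inside
`P ^ 2` does not decrease the weighted trace. -/
theorem sum_mul_diag_sq_le {P : Matrix (Fin n) (Fin n) ℂ} (hP : P.IsHermitian)
    {w K : Fin n → ℝ} (hw : Antitone w) (hK : Monotone K) :
    ∑ i, w i * (K i * ((P * P) i i).re) ≤
      ∑ i, w i * ((P * diagonal (fun i => (K i : ℂ)) * P) i i).re := by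
  have hent : ∀ i j, P i j * P j i = (Complex.normSq (P i j) : ℂ) := fun i j => by
    rw [← hP.apply i j, Complex.star_def, mul_comm, Complex.normSq_eq_conj_mul_self,
      Complex.conj_conj, mul_comm]
  have hsymm : ∀ i j, Complex.normSq (P i j) = Complex.normSq (P j i) := fun i j => by
    rw [← hP.apply i j, Complex.star_def, Complex.normSq_conj]
  have h1 : ∀ i, ((P * P) i i).re = ∑ j, Complex.normSq (P i j) := fun i => by
    rw [Matrix.mul_apply, Complex.re_sum]
    exact Finset.sum_congr rfl fun j _ => by rw [hent, Complex.ofReal_re]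
  have h2 : ∀ i, ((P * diagonal (fun i => (K i : ℂ)) * P) i i).re =
      ∑ j, Complex.normSq (P i j) * K j := fun i => by
    rw [Matrix.mul_apply, Complex.re_sum]
    exact Finset.sum_congr rfl fun j _ => by
      rw [mul_diagonal, mul_right_comm, hent, ← Complex.ofReal_mul, Complex.ofReal_re]
  simp only [h1, h2, Finset.mul_sum]
  -- after symmetrization the difference is `½ ∑ |Pᵢⱼ|² (wᵢ - wⱼ) (Kⱼ - Kᵢ)`,
  -- whose factors have the same sign
  rw [← sub_nonneg, ← Finset.sum_sub_distrib]
  simp only [← Finset.sum_sub_distrib]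
  set F : Fin n → Fin n → ℝ := fun i j =>
    w i * (Complex.normSq (P i j) * K j) - w i * (K i * Complex.normSq (P i j)) with hF
  have hswap : ∑ i, ∑ j, F i j = ∑ i, ∑ j, F j i := Finset.sum_comm
  have hpos : 0 ≤ ∑ i, ∑ j, (F i j + F j i) := by
    refine Finset.sum_nonneg fun i _ => Finset.sum_nonneg fun j _ => ?_
    have : F i j + F j i = Complex.normSq (P i j) * ((w i - w j) * (K j - K i)) := by
      simp only [hF, hsymm j i]
      ring
    rw [this]
    refine mul_nonneg (Complex.normSq_nonneg _) ?_
    rcases le_total i j with hij | hij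
    · exact mul_nonneg (sub_nonneg.2 (hw hij)) (sub_nonneg.2 (hK hij))
    · exact mul_nonneg_of_nonpos_of_nonpos (sub_nonpos.2 (hw hij)) (sub_nonpos.2 (hK hij))
  simp only [Finset.sum_add_distrib] at hpos
  linarith

theorem cfc_add_const_rpow {S : Matrix (Fin n) (Fin n) ℂ} (hS : 0 ≤ S) {δ : ℝ} (hδ : 0 < δ)
    (p : ℝ) : (S + algebraMap ℝ _ δ) ^ p = cfc (fun x : ℝ => (x + δ) ^ p) S := by
  have hsa : IsSelfAdjoint S := IsSelfAdjoint.of_nonneg hS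
  have h0 : 0 ≤ S + algebraMap ℝ (Matrix (Fin n) (Fin n) ℂ) δ :=
    add_nonneg hS (algebraMap_nonneg _ hδ.le)
  rw [CFC.rpow_eq_cfc_real h0, cfc_comp' (fun x : ℝ => x ^ p) (fun x => x + δ) S
    (((S.finite_real_spectrum).image _).continuousOn _) (continuousOn_spectrum_real _ _) hsa,
    cfc_add_const δ (fun x => x) S (continuousOn_spectrum_real _ _) hsa, cfc_id' ℝ S hsa]

/-- If `0 ≤ A ≤ S` then `A^{1/2} (S + δ)^{q-1} A^{1/2} ≤ A ^ q`, because `t ↦ t ^ (q - 1)` is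
operator antitone. -/
theorem sqrt_mul_rpow_mul_sqrt_le {A S : Matrix (Fin n) (Fin n) ℂ} (hA : 0 ≤ A) (hAS : A ≤ S)
    {δ q : ℝ} (hδ : 0 < δ) (hq0 : 0 < q) (hq1 : q ≤ 1) :
    CFC.sqrt A * cfc (fun x : ℝ => (x + δ) ^ (q - 1)) S * CFC.sqrt A ≤ A ^ q := by
  have hpos : IsStrictlyPositive (A + algebraMap ℝ (Matrix (Fin n) (Fin n) ℂ) δ) :=
    IsStrictlyPositive.nonneg_add hA (isStrictlyPositive_algebraMap hδ)
  have h1 : cfc (fun x : ℝ => (x + δ) ^ (q - 1)) S ≤ cfc (fun x : ℝ => (x + δ) ^ (q - 1)) A := by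
    rw [← cfc_add_const_rpow hA hδ, ← cfc_add_const_rpow (hA.trans hAS) hδ, ← neg_sub 1 q]
    exact CFC.rpow_neg_le_rpow_neg hpos (by gcongr) ⟨by linarith, by linarith⟩
  have hsq : IsSelfAdjoint (CFC.sqrt A) := IsSelfAdjoint.of_nonneg (CFC.sqrt_nonneg A)
  refine (hsq.conjugate_le_conjugate h1).trans ?_
  have hsqrt : CFC.sqrt A = cfc Real.sqrt A := by
    rw [CFC.sqrt_eq_rpow, CFC.rpow_eq_cfc_real hA]
    exact cfc_congr fun x _ => (Real.sqrt_eq_rpow x).symm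
  rw [hsqrt, ← cfc_mul _ _ A (continuousOn_spectrum_real _ _) (continuousOn_spectrum_real _ _),
    ← cfc_mul _ _ A (continuousOn_spectrum_real _ _) (continuousOn_spectrum_real _ _),
    CFC.rpow_eq_cfc_real hA]
  refine cfc_mono (fun x hx => ?_) (continuousOn_spectrum_real _ _) (continuousOn_spectrum_real _ _)
  have hx0 : 0 ≤ x := spectrum_nonneg_of_nonneg hA hx
  rw [mul_right_comm, Real.mul_self_sqrt hx0]
  rcases hx0.eq_or_lt with rfl | hx0
  · rw [zero_mul, Real.zero_rpow hq0.ne']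
  · calc x * (x + δ) ^ (q - 1) ≤ x * x ^ (q - 1) := by
          gcongr ?_ * ?_
          exact Real.rpow_le_rpow_of_nonpos hx0 (by linarith) (by linarith)
      _ = x ^ q := by rw [Real.rpow_sub_one hx0.ne', mul_div_cancel₀ _ hx0.ne']

/-- Weak majorization form of the Ando–Zhan subadditivity inequality: for `0 < q ≤ 1`, in a
basis diagonalizing `∑ Aₖ` with decreasing eigenvalues, the eigenvalues of `(∑ Aₖ) ^ q` are
dominated by the diagonal of `∑ Aₖ ^ q`. -/
theorem weighted_sum_rpow_le_conjDiag {ι : Type*} [Fintype ι]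
    {A : ι → Matrix (Fin n) (Fin n) ℂ} (hA : ∀ k, 0 ≤ A k)
    {U : Matrix (Fin n) (Fin n) ℂ} (hU : U ∈ unitaryGroup (Fin n) ℂ) {l : Fin n → ℝ}
    (hl : Antitone l) (hl0 : ∀ i, 0 ≤ l i)
    (hUl : ∀ f : ℝ → ℝ, cfc f (∑ k, A k) = U * diagonal (fun i => (f (l i) : ℂ)) * Uᴴ)
    {q : ℝ} (hq0 : 0 < q) (hq1 : q ≤ 1) {w : Fin n → ℝ} (hw : Antitone w) (hw0 : ∀ i, 0 ≤ w i) :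
    ∑ i, w i * l i ^ q ≤ ∑ i, w i * conjDiag U (∑ k, A k ^ q) i := by
  have hS : 0 ≤ ∑ k, A k := Finset.sum_nonneg fun k _ => hA k
  have hUU : Uᴴ * U = 1 := mem_unitaryGroup_iff'.1 hU
  have hUU' : U * Uᴴ = 1 := mem_unitaryGroup_iff.1 hU
  have hδ : ∀ δ : ℝ, 0 < δ →
      ∑ i, w i * (l i * (l i + δ) ^ (q - 1)) ≤ ∑ i, w i * conjDiag U (∑ k, A k ^ q) i := by
    intro δ hδ
    set K : Fin n → ℝ := fun i => (l i + δ) ^ (q - 1) with hKdef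
    have hK : Monotone K := fun i j hij =>
      Real.rpow_le_rpow_of_nonpos (by linarith [hl0 j]) (by linarith [hl hij]) (by linarith)
    have hk : ∀ k, ∑ i, w i * (K i * conjDiag U (A k) i) ≤ ∑ i, w i * conjDiag U (A k ^ q) i := by
      intro k
      have hsq : (CFC.sqrt (A k)).IsHermitian := isHermitian_of_nonneg (CFC.sqrt_nonneg _)
      have hP : (Uᴴ * CFC.sqrt (A k) * U).IsHermitian := isHermitian_conjTranspose_mul_mul U hsq
      have hPP : (Uᴴ * CFC.sqrt (A k) * U) * (Uᴴ * CFC.sqrt (A k) * U) = Uᴴ * A k * U := by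
        calc _ = Uᴴ * CFC.sqrt (A k) * (U * Uᴴ) * CFC.sqrt (A k) * U := by
              simp only [Matrix.mul_assoc]
          _ = Uᴴ * (CFC.sqrt (A k) * CFC.sqrt (A k)) * U := by
              rw [hUU', Matrix.mul_one, Matrix.mul_assoc Uᴴ]
          _ = _ := by rw [CFC.sqrt_mul_sqrt_self _ (hA k)]
      have hPKP : (Uᴴ * CFC.sqrt (A k) * U) * diagonal (fun i => (K i : ℂ)) *
          (Uᴴ * CFC.sqrt (A k) * U) =
          Uᴴ * (CFC.sqrt (A k) * cfc (fun x : ℝ => (x + δ) ^ (q - 1)) (∑ k, A k) *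
            CFC.sqrt (A k)) * U := by
        rw [hUl]
        simp only [Matrix.mul_assoc, hKdef]
      have h1 := sum_mul_diag_sq_le hP hw hK
      rw [hPP, hPKP] at h1
      refine h1.trans (Finset.sum_le_sum fun i _ => mul_le_mul_of_nonneg_left ?_ (hw0 i))
      exact conjDiag_mono U (sqrt_mul_rpow_mul_sqrt_le (hA k)
        (Finset.single_le_sum (fun k _ => hA k) (Finset.mem_univ k)) hδ hq0 hq1) i
    have hli : ∀ i, l i = ∑ k, conjDiag U (A k) i := fun i => by
      rw [← conjDiag_sum, ← conjDiag_cfc_id hS, hUl, conjDiag_diagonalization hU]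
    calc ∑ i, w i * (l i * K i) = ∑ k, ∑ i, w i * (K i * conjDiag U (A k) i) := by
          rw [Finset.sum_comm]
          refine Finset.sum_congr rfl fun i _ => ?_
          rw [← Finset.mul_sum, ← Finset.mul_sum, ← hli, mul_comm (l i)]
      _ ≤ ∑ k, ∑ i, w i * conjDiag U (A k ^ q) i := Finset.sum_le_sum fun k _ => hk k
      _ = _ := by
          rw [Finset.sum_comm]
          refine Finset.sum_congr rfl fun i _ => ?_
          rw [← Finset.mul_sum, conjDiag_sum]
  -- if `l i = 0` the term vanishes for every `δ > 0`, as does `l i ^ q`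
  have hlim : Tendsto (fun δ : ℝ => ∑ i, w i * (l i * (l i + δ) ^ (q - 1))) (𝓝[>] 0)
      (𝓝 (∑ i, w i * l i ^ q)) := by
    refine tendsto_finsetSum _ fun i _ => Tendsto.const_mul _ ?_
    rcases (hl0 i).eq_or_lt with h0 | h0
    · simp [← h0, Real.zero_rpow hq0.ne']
    · have hval : l i ^ q = l i * (l i + 0) ^ (q - 1) := by
        rw [add_zero, Real.rpow_sub_one h0.ne', mul_div_cancel₀ _ h0.ne']
      rw [hval]
      have hc : ContinuousAt (fun δ : ℝ => l i * (l i + δ) ^ (q - 1)) 0 := by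
        refine ContinuousAt.mul continuousAt_const (ContinuousAt.rpow_const (by fun_prop) (Or.inl ?_))
        simpa using h0.ne'
      exact hc.tendsto.mono_left nhdsWithin_le_nhds
  exact le_of_tendsto hlim (eventually_nhdsWithin_of_forall fun δ hδ' => hδ δ hδ')

/-- The tangent line of `t ^ q` at `m` lies below the graph when `q ≥ 1`. -/
theorem rpow_add_tangent_le {q m d : ℝ} (hq : 1 ≤ q) (hm : 0 ≤ m) (hd : 0 ≤ d) :
    m ^ q + q * m ^ (q - 1) * (d - m) ≤ d ^ q := by
  rcases hm.eq_or_lt with rfl | hm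
  · rcases hq.eq_or_lt with rfl | hq
    · simp
    · rw [Real.zero_rpow (by linarith), Real.zero_rpow (by linarith)]
      simpa using Real.rpow_nonneg hd q
  · have h := one_add_mul_self_le_rpow_one_add (s := d / m - 1)
      (by linarith [div_nonneg hd hm.le]) hq
    rw [add_sub_cancel, Real.div_rpow hd hm.le, le_div_iff₀ (Real.rpow_pos_of_pos hm q)] at h
    refine le_trans (le_of_eq ?_) h
    rw [Real.rpow_sub_one hm.ne']
    field_simp

theorem seminorm_real_smul (N : Seminorm ℂ (Matrix (Fin n) (Fin n) ℂ)) {c : ℝ} (hc : 0 ≤ c)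
    (X : Matrix (Fin n) (Fin n) ℂ) : N (c • X) = c * N X := by
  have : c • X = (c : ℂ) • X := by
    ext i j
    simp
  rw [this, map_smul_eq_mul, Complex.norm_real, Real.norm_of_nonneg hc]

namespace IsUnitarilyInvariantNorm

variable {N : Seminorm ℂ (Matrix (Fin n) (Fin n) ℂ)} {ι : Type*} [Fintype ι]
  {A : ι → Matrix (Fin n) (Fin n) ℂ}

/-- Unitarily invariant norms are monotone on positive semidefinite matrices. -/
theorem mono (hN : IsUnitarilyInvariantNorm N) {X Y : Matrix (Fin n) (Fin n) ℂ} (hX : 0 ≤ X)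
    (hXY : X ≤ Y) : N X ≤ N Y := by
  obtain ⟨U, hU, l, hl, hl0, hUl⟩ := (isHermitian_of_nonneg hX).exists_antitone_diagonalization
  have hX' : X = U * diagonal (fun i => (l i : ℂ)) * Uᴴ := by
    rw [← hUl fun x => x, cfc_id' ℝ X (IsSelfAdjoint.of_nonneg hX)]
  have h := hN.le_of_weighted_sum_conjDiag_le hU (isHermitian_of_nonneg (hX.trans hXY)) hl
    (hl0 hX) (fun w _ hw0 => Finset.sum_le_sum fun i _ => mul_le_mul_of_nonneg_left ?_ (hw0 i))
  · rwa [← hX'] at h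
  · rw [← conjDiag_diagonalization hU l i, ← hX']
    exact conjDiag_mono U hXY i

/-- Ando–Zhan subadditivity for concave powers. -/
theorem map_sum_rpow_le (hN : IsUnitarilyInvariantNorm N) (hA : ∀ k, 0 ≤ A k) {q : ℝ}
    (hq0 : 0 < q) (hq1 : q ≤ 1) : N ((∑ k, A k) ^ q) ≤ N (∑ k, A k ^ q) := by
  have hS : 0 ≤ ∑ k, A k := Finset.sum_nonneg fun k _ => hA k
  obtain ⟨U, hU, l, hl, hl0, hUl⟩ := (isHermitian_of_nonneg hS).exists_antitone_diagonalization
  replace hl0 := hl0 hS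
  rw [CFC.rpow_eq_cfc_real hS, hUl]
  exact hN.le_of_weighted_sum_conjDiag_le hU
    (isHermitian_of_nonneg (Finset.sum_nonneg fun k _ => CFC.rpow_nonneg))
    (fun i j hij => Real.rpow_le_rpow (hl0 j) (hl hij) hq0.le)
    (fun i => Real.rpow_nonneg (hl0 i) q)
    (fun w hw hw0 => weighted_sum_rpow_le_conjDiag hA hU hl hl0 hUl hq0 hq1 hw hw0)

/-- Ando–Zhan superadditivity for convex powers. It follows from subadditivity of `t ^ (1 / q)`
applied to the matrices `Aₖ ^ q`, since weak majorization is preserved by `t ↦ t ^ q`. -/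
theorem map_sum_rpow_ge (hN : IsUnitarilyInvariantNorm N) (hA : ∀ k, 0 ≤ A k) {q : ℝ}
    (hq : 1 ≤ q) : N (∑ k, A k ^ q) ≤ N ((∑ k, A k) ^ q) := by
  have hq0 : 0 < q := by linarith
  have hB : ∀ k, 0 ≤ A k ^ q := fun k => CFC.rpow_nonneg
  have hS : 0 ≤ ∑ k, A k := Finset.sum_nonneg fun k _ => hA k
  have hT : 0 ≤ ∑ k, A k ^ q := Finset.sum_nonneg fun k _ => hB k
  obtain ⟨U, hU, l, hl, hl0, hUl⟩ := (isHermitian_of_nonneg hT).exists_antitone_diagonalization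
  replace hl0 := hl0 hT
  have hT' : ∑ k, A k ^ q = U * diagonal (fun i => (l i : ℂ)) * Uᴴ := by
    rw [← hUl fun x => x, cfc_id' ℝ _ (IsSelfAdjoint.of_nonneg hT)]
  have hroot : ∀ k, (A k ^ q) ^ q⁻¹ = A k := fun k => by
    rw [CFC.rpow_rpow_of_exponent_nonneg _ _ _ hq0.le (inv_nonneg.2 hq0.le) (hA k),
      mul_inv_cancel₀ hq0.ne', CFC.rpow_one _ (hA k)]
  rw [hT']
  refine hN.le_of_weighted_sum_conjDiag_le hU (isHermitian_of_nonneg CFC.rpow_nonneg) hl hl0 ?_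
  intro w hw hw0
  set m : Fin n → ℝ := fun i => l i ^ q⁻¹ with hm_def
  set d : Fin n → ℝ := fun i => conjDiag U (∑ k, A k) i with hd_def
  have hm0 : ∀ i, 0 ≤ m i := fun i => Real.rpow_nonneg (hl0 i) _
  have hd0 : ∀ i, 0 ≤ d i := fun i => conjDiag_nonneg U hS i
  have hml : ∀ i, m i ^ q = l i := fun i => Real.rpow_inv_rpow (hl0 i) hq0.ne'
  have hm : Antitone m := fun i j hij =>
    Real.rpow_le_rpow (hl0 j) (hl hij) (inv_nonneg.2 hq0.le)
  have htan : ∀ i, m i ^ q + q * m i ^ (q - 1) * (d i - m i) ≤ d i ^ q :=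
    fun i => rpow_add_tangent_le hq (hm0 i) (hd0 i)
  -- the slopes `q * m i ^ (q - 1)` are decreasing, so they can be absorbed into the weights
  have hmaj := weighted_sum_rpow_le_conjDiag hB hU hl hl0 hUl (inv_pos.2 hq0)
    (inv_le_one_of_one_le₀ hq)
    (w := fun i => w i * (q * m i ^ (q - 1)))
    (fun i j hij => mul_le_mul (hw hij) (mul_le_mul_of_nonneg_left
      (Real.rpow_le_rpow (hm0 j) (hm hij) (by linarith)) hq0.le)
      (mul_nonneg hq0.le (Real.rpow_nonneg (hm0 j) _)) (hw0 i))
    (fun i => mul_nonneg (hw0 i) (mul_nonneg hq0.le (Real.rpow_nonneg (hm0 i) _)))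
  simp only [hroot] at hmaj
  calc ∑ i, w i * l i
      ≤ ∑ i, w i * l i + (∑ i, w i * (q * m i ^ (q - 1)) * d i -
          ∑ i, w i * (q * m i ^ (q - 1)) * m i) := le_add_of_nonneg_right (sub_nonneg.2 hmaj)
    _ = ∑ i, w i * (m i ^ q + q * m i ^ (q - 1) * (d i - m i)) := by
        rw [← Finset.sum_sub_distrib, ← Finset.sum_add_distrib]
        refine Finset.sum_congr rfl fun i _ => ?_
        rw [hml]
        ring
    _ ≤ ∑ i, w i * d i ^ q :=
        Finset.sum_le_sum fun i _ => mul_le_mul_of_nonneg_left (htan i) (hw0 i)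
    _ ≤ ∑ i, w i * conjDiag U ((∑ k, A k) ^ q) i :=
        Finset.sum_le_sum fun i _ => mul_le_mul_of_nonneg_left (conjDiag_rpow_le hS hU hq i) (hw0 i)

/-- Convexity of `t ^ q` for `q ≥ 1`, in norm. -/
theorem map_sum_rpow_le_card_mul (hN : IsUnitarilyInvariantNorm N) (hA : ∀ k, 0 ≤ A k) {q : ℝ}
    (hq : 1 ≤ q) :
    N ((∑ k, A k) ^ q) ≤ (Fintype.card ι : ℝ) ^ (q - 1) * N (∑ k, A k ^ q) := by
  have hc : (0 : ℝ) ≤ (Fintype.card ι : ℝ) ^ (q - 1) := by positivity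
  have hS : 0 ≤ ∑ k, A k := Finset.sum_nonneg fun k _ => hA k
  have hT : 0 ≤ ∑ k, A k ^ q := Finset.sum_nonneg fun k _ => CFC.rpow_nonneg
  obtain ⟨U, hU, l, hl, hl0, hUl⟩ := (isHermitian_of_nonneg hS).exists_antitone_diagonalization
  replace hl0 := hl0 hS
  rw [← seminorm_real_smul N hc, CFC.rpow_eq_cfc_real hS, hUl]
  refine hN.le_of_weighted_sum_conjDiag_le hU (isHermitian_of_nonneg (smul_nonneg hc hT))
    (fun i j hij => Real.rpow_le_rpow (hl0 j) (hl hij) (by linarith))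
    (fun i => Real.rpow_nonneg (hl0 i) q)
    (fun w _ hw0 => Finset.sum_le_sum fun i _ => mul_le_mul_of_nonneg_left ?_ (hw0 i))
  have hli : l i = ∑ k, |conjDiag U (A k) i| := by
    simp only [abs_of_nonneg (conjDiag_nonneg U (hA _) i)]
    rw [← conjDiag_sum, ← conjDiag_cfc_id hS, hUl, conjDiag_diagonalization hU]
  rw [conjDiag_smul, conjDiag_sum, hli]
  refine (Real.rpow_sum_le_const_mul_sum_rpow _ _ hq).trans ?_
  rw [Finset.card_univ]
  refine mul_le_mul_of_nonneg_left (Finset.sum_le_sum fun k _ => ?_) hc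
  rw [abs_of_nonneg (conjDiag_nonneg U (hA _) i)]
  exact conjDiag_rpow_le (hA k) hU hq i

/-- Operator concavity of `t ^ q` for `0 < q ≤ 1`, in norm. -/
theorem card_mul_map_sum_rpow_le [Nonempty ι] (hN : IsUnitarilyInvariantNorm N)
    (hA : ∀ k, 0 ≤ A k) {q : ℝ} (hq0 : 0 < q) (hq1 : q ≤ 1) :
    (Fintype.card ι : ℝ) ^ (q - 1) * N (∑ k, A k ^ q) ≤ N ((∑ k, A k) ^ q) := by
  have hm : (0 : ℝ) < Fintype.card ι := by exact_mod_cast Fintype.card_pos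
  set m : ℝ := (Fintype.card ι : ℝ) with hm_def
  have hS : 0 ≤ ∑ k, A k := Finset.sum_nonneg fun k _ => hA k
  have hT : 0 ≤ ∑ k, A k ^ q := Finset.sum_nonneg fun k _ => CFC.rpow_nonneg
  have hconc := (CFC.concaveOn_rpow (A := Matrix (Fin n) (Fin n) ℂ) ⟨hq0.le, hq1⟩).le_map_sum
    (t := Finset.univ) (w := fun _ : ι => m⁻¹) (p := A) (fun _ _ => inv_nonneg.2 hm.le)
    (by simp [← hm_def, hm.ne']) (fun k _ => hA k)
  simp only [← Finset.smul_sum] at hconc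
  rw [CFC.smul_rpow hS (inv_nonneg.2 hm.le)] at hconc
  have h := hN.mono (smul_nonneg (inv_nonneg.2 hm.le) hT) hconc
  rw [seminorm_real_smul N (inv_nonneg.2 hm.le), seminorm_real_smul N (by positivity),
    Real.inv_rpow hm.le] at h
  rw [Real.rpow_sub_one hm.ne', div_eq_mul_inv, mul_assoc]
  calc m ^ q * (m⁻¹ * N (∑ k, A k ^ q)) ≤ m ^ q * ((m ^ q)⁻¹ * N ((∑ k, A k) ^ q)) := by gcongr
    _ = _ := mul_inv_cancel_left₀ (by positivity) _

end IsUnitarilyInvariantNorm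

/-! ### The Hlawka-type inequalities -/

theorem matAbsPow_eq_rpow (X : Matrix (Fin n) (Fin n) ℂ) {p : ℝ} (hp : 0 ≤ p) :
    matAbsPow X p = (Xᴴ * X) ^ (p / 2) := by
  unfold matAbsPow
  rw [CFC.abs, CFC.sqrt_eq_rpow,
    CFC.rpow_rpow_of_exponent_nonneg _ _ _ (by norm_num) hp (star_mul_self_nonneg X),
    star_eq_conjTranspose]
  congr 1
  ring

theorem matAbsPow_zero {p : ℝ} (hp : 0 < p) :
    matAbsPow (0 : Matrix (Fin n) (Fin n) ℂ) p = 0 := by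
  unfold matAbsPow
  rw [CFC.abs_zero]
  exact CFC.zero_rpow hp.ne'

theorem matAbsPow_neg (X : Matrix (Fin n) (Fin n) ℂ) (p : ℝ) :
    matAbsPow (-X) p = matAbsPow X p := by
  unfold matAbsPow
  rw [CFC.abs_neg]

theorem matAbsPow_add_self (X : Matrix (Fin n) (Fin n) ℂ) {p : ℝ} (hp : 0 ≤ p) :
    matAbsPow (X + X) p = (2 : ℝ) ^ p • matAbsPow X p := by
  have hX : 0 ≤ Xᴴ * X := star_mul_self_nonneg X
  have h : (X + X)ᴴ * (X + X) = ((2 : ℝ) ^ (2 : ℝ)) • (Xᴴ * X) := by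
    rw [conjTranspose_add, ← two_smul ℝ X, ← two_smul ℝ Xᴴ, smul_mul_smul_comm]
    norm_num
  rw [matAbsPow_eq_rpow _ hp, matAbsPow_eq_rpow _ hp, h,
    CFC.smul_rpow hX (by positivity), ← Real.rpow_mul (by norm_num)]
  congr 2
  ring

/-- The squared moduli of the three pairwise sums have the same sum as the four squared moduli of
`A + B + C`, `A`, `B` and `C`. -/
theorem sum_conjTranspose_mul_self_pairwise_add (A B C : Matrix (Fin n) (Fin n) ℂ) :
    (A + B)ᴴ * (A + B) + (B + C)ᴴ * (B + C) + (C + A)ᴴ * (C + A) =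
      (A + B + C)ᴴ * (A + B + C) + Aᴴ * A + Bᴴ * B + Cᴴ * C := by
  simp only [conjTranspose_add]
  noncomm_ring

theorem four_rpow_half_sub_one (p : ℝ) : (4 : ℝ) ^ (p / 2 - 1) = 2 ^ (p - 2) := by
  rw [show (4 : ℝ) = 2 ^ (2 : ℝ) by norm_num, ← Real.rpow_mul (by norm_num)]
  congr 1
  ring

theorem two_rpow_eq_mul_four (p : ℝ) : (2 : ℝ) ^ p = 2 ^ (p - 2) * 4 := by
  rw [Real.rpow_sub (by norm_num)]
  norm_num

/-- At `(A, A, -A)` one side reduces to `|2A| ^ p` and the other to four copies of `|A| ^ p`. -/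
theorem map_matAbsPow_pairwise_add_eq (N : Seminorm ℂ (Matrix (Fin n) (Fin n) ℂ)) {p : ℝ}
    (hp : 0 < p) (A : Matrix (Fin n) (Fin n) ℂ) :
    N (matAbsPow (A + A) p + matAbsPow (A + -A) p + matAbsPow (-A + A) p) =
        (2 : ℝ) ^ p * N (matAbsPow A p) ∧
      N (matAbsPow (A + A + -A) p + matAbsPow A p + matAbsPow A p + matAbsPow (-A) p) =
        4 * N (matAbsPow A p) := by
  constructor
  · rw [add_neg_cancel, neg_add_cancel, matAbsPow_zero hp, add_zero, add_zero,
      matAbsPow_add_self A hp.le, seminorm_real_smul N (by positivity)]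
  · rw [add_neg_cancel_right, matAbsPow_neg, ← seminorm_real_smul N (by norm_num)]
    congr 1
    module

namespace IsUnitarilyInvariantNorm

variable {N : Seminorm ℂ (Matrix (Fin n) (Fin n) ℂ)}

theorem map_matAbsPow_pairwise_add_le (hN : IsUnitarilyInvariantNorm N) {p : ℝ} (hp : 2 ≤ p)
    (A B C : Matrix (Fin n) (Fin n) ℂ) :
    N (matAbsPow (A + B) p + matAbsPow (B + C) p + matAbsPow (C + A) p) ≤
      (2 : ℝ) ^ (p - 2) *
        N (matAbsPow (A + B + C) p + matAbsPow A p + matAbsPow B p + matAbsPow C p) := by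
  have hp0 : 0 ≤ p := by linarith
  have hq : 1 ≤ p / 2 := by linarith
  have hX : ∀ k : Fin 3, 0 ≤ ![(A + B)ᴴ * (A + B), (B + C)ᴴ * (B + C), (C + A)ᴴ * (C + A)] k := by
    intro k
    fin_cases k <;> exact star_mul_self_nonneg _
  have hY : ∀ k : Fin 4, 0 ≤ ![(A + B + C)ᴴ * (A + B + C), Aᴴ * A, Bᴴ * B, Cᴴ * C] k := by
    intro k
    fin_cases k <;> exact star_mul_self_nonneg _
  have h1 := hN.map_sum_rpow_ge hX hq
  have h2 := hN.map_sum_rpow_le_card_mul hY hq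
  simp only [Fin.sum_univ_three, Fin.sum_univ_four, Fintype.card_fin, Nat.cast_ofNat,
    four_rpow_half_sub_one, Matrix.cons_val] at h1 h2
  rw [sum_conjTranspose_mul_self_pairwise_add] at h1
  simp only [matAbsPow_eq_rpow _ hp0]
  exact h1.trans h2

theorem le_map_matAbsPow_pairwise_add (hN : IsUnitarilyInvariantNorm N) {p : ℝ} (hp0 : 0 < p)
    (hp : p ≤ 2) (A B C : Matrix (Fin n) (Fin n) ℂ) :
    (2 : ℝ) ^ (p - 2) *
        N (matAbsPow (A + B + C) p + matAbsPow A p + matAbsPow B p + matAbsPow C p) ≤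
      N (matAbsPow (A + B) p + matAbsPow (B + C) p + matAbsPow (C + A) p) := by
  have hq0 : 0 < p / 2 := by linarith
  have hq : p / 2 ≤ 1 := by linarith
  have hX : ∀ k : Fin 3, 0 ≤ ![(A + B)ᴴ * (A + B), (B + C)ᴴ * (B + C), (C + A)ᴴ * (C + A)] k := by
    intro k
    fin_cases k <;> exact star_mul_self_nonneg _
  have hY : ∀ k : Fin 4, 0 ≤ ![(A + B + C)ᴴ * (A + B + C), Aᴴ * A, Bᴴ * B, Cᴴ * C] k := by
    intro k
    fin_cases k <;> exact star_mul_self_nonneg _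
  have h1 := hN.map_sum_rpow_le hX hq0 hq
  have h2 := hN.card_mul_map_sum_rpow_le hY hq0 hq
  simp only [Fin.sum_univ_three, Fin.sum_univ_four, Fintype.card_fin, Nat.cast_ofNat,
    four_rpow_half_sub_one, Matrix.cons_val] at h1 h2
  rw [sum_conjTranspose_mul_self_pairwise_add] at h1
  simp only [matAbsPow_eq_rpow _ hp0.le]
  exact h2.trans h1

theorem map_matAbsPow_one_pos (hN : IsUnitarilyInvariantNorm N) (hn : 1 ≤ n) (p : ℝ) :
    0 < N (matAbsPow 1 p) := by
  have : Nonempty (Fin n) := ⟨⟨0, hn⟩⟩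
  have h1 : matAbsPow (1 : Matrix (Fin n) (Fin n) ℂ) p = 1 := by
    unfold matAbsPow
    rw [CFC.abs_one, CFC.one_rpow]
  rw [h1]
  exact (apply_nonneg N _).lt_of_ne fun h => one_ne_zero (hN.definite 1 h.symm)

end IsUnitarilyInvariantNorm

end

theorem theorem1p18 {n : ℕ} (N : Seminorm ℂ (Matrix (Fin n) (Fin n) ℂ))
    (hN : IsUnitarilyInvariantNorm N) :
    -- the inequality for `p ≥ 2`
    (∀ p : ℝ, 2 ≤ p → ∀ A B C : Matrix (Fin n) (Fin n) ℂ,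
      N (matAbsPow (A + B) p + matAbsPow (B + C) p + matAbsPow (C + A) p) ≤
        (2 : ℝ) ^ (p - 2) *
          N (matAbsPow (A + B + C) p + matAbsPow A p + matAbsPow B p + matAbsPow C p)) ∧
    -- the reversed inequality for `0 < p ≤ 2`
    (∀ p : ℝ, 0 < p → p ≤ 2 → ∀ A B C : Matrix (Fin n) (Fin n) ℂ,
      (2 : ℝ) ^ (p - 2) *
          N (matAbsPow (A + B + C) p + matAbsPow A p + matAbsPow B p + matAbsPow C p) ≤
        N (matAbsPow (A + B) p + matAbsPow (B + C) p + matAbsPow (C + A) p)) ∧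
    -- equality for all `p > 0` whenever `A = B = -C ≠ 0`
    (∀ p : ℝ, 0 < p → ∀ A B C : Matrix (Fin n) (Fin n) ℂ, A = B → B = -C → A ≠ 0 →
      N (matAbsPow (A + B) p + matAbsPow (B + C) p + matAbsPow (C + A) p) =
        (2 : ℝ) ^ (p - 2) *
          N (matAbsPow (A + B + C) p + matAbsPow A p + matAbsPow B p + matAbsPow C p)) ∧
    -- for `p ≥ 2` no smaller constant works
    (1 ≤ n → ∀ p : ℝ, 2 ≤ p → ∀ c : ℝ,
      (∀ A B C : Matrix (Fin n) (Fin n) ℂ,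
        N (matAbsPow (A + B) p + matAbsPow (B + C) p + matAbsPow (C + A) p) ≤
          c * N (matAbsPow (A + B + C) p + matAbsPow A p + matAbsPow B p + matAbsPow C p)) →
      (2 : ℝ) ^ (p - 2) ≤ c) ∧
    -- for `0 < p ≤ 2` no larger constant works
    (1 ≤ n → ∀ p : ℝ, 0 < p → p ≤ 2 → ∀ c : ℝ,
      (∀ A B C : Matrix (Fin n) (Fin n) ℂ,
        c * N (matAbsPow (A + B + C) p + matAbsPow A p + matAbsPow B p + matAbsPow C p) ≤
          N (matAbsPow (A + B) p + matAbsPow (B + C) p + matAbsPow (C + A) p)) →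
      c ≤ (2 : ℝ) ^ (p - 2)) := by
  refine ⟨fun p hp A B C => hN.map_matAbsPow_pairwise_add_le hp A B C,
    fun p hp0 hp A B C => hN.le_map_matAbsPow_pairwise_add hp0 hp A B C, ?_, ?_, ?_⟩
  · rintro p hp A B C rfl hAC -
    obtain rfl : C = -A := by rw [hAC, neg_neg]
    obtain ⟨h1, h2⟩ := map_matAbsPow_pairwise_add_eq N hp A
    rw [h1, h2, two_rpow_eq_mul_four, mul_assoc]
  · intro hn p hp c h
    obtain ⟨h1, h2⟩ :=
      map_matAbsPow_pairwise_add_eq N (p := p) (by linarith) 1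
    have h3 := h 1 1 (-1)
    have h0 := hN.map_matAbsPow_one_pos hn p
    rw [h1, h2, two_rpow_eq_mul_four, mul_assoc] at h3
    exact le_of_mul_le_mul_right h3 (by positivity)
  · intro hn p hp _ c h
    obtain ⟨h1, h2⟩ := map_matAbsPow_pairwise_add_eq N hp 1
    have h3 := h 1 1 (-1)
    have h0 := hN.map_matAbsPow_one_pos hn p
    rw [h1, h2, two_rpow_eq_mul_four, mul_assoc] at h3
    exact le_of_mul_le_mul_right h3 (by positivity)
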